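/- Let $K\ge 2$, $A\in\mathbb Z^{K\times K}$, $M\in\mathbb R^{K\times K}$, and let $G=(AA^{\top})\circ M$ be the interference coupling matrix ($\circ$ is the entrywise product). Assume that $G$ is invertible and that all entries $g'_{i,j}$ of $G^{-1}$ are positive. For entrywise positive $x,y\in\mathbb R^K$ let $x\oslash y$ be the entrywise quotient, $\mathbf 1$ the all-ones vector, $d_H(x,y)=\log\frac{\max_i x_i/y_i}{\min_i x_i/y_i}$ the Hilbert metric, and $\Gamma(x)=x/\prod_{i=1}^K x_i^{1/K}$. Let $\Delta(G^{-1})=\sup\{d_H(G^{-1}x,G^{-1}y): x,y\in\mathbb R^K \text{ entrywise positive}\}$ be the projective diameter of $G^{-1}$. Let $\epsilon>0$ and let $d^{(0)}\in\mathbb R^K$ be entrywise positive. The Reciprocal Approximation algorithm started at $d^{(0)}$ computes, in its successive loop passes $t=0,1,2,\dots$, the vector $d^{(t+1)}=\Gamma\big(G^{-1}(\mathbf 1\oslash d^{(t)})\big)$, and it halts after the first pass $t$ with $d_H(d^{(t+1)},d^{(t)})\le\epsilon$; this index is denoted $t_{\mathrm{RA}}$ (so the loop body is executed $t_{\mathrm{RA}}+1$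 times and the output is $d^{(t_{\mathrm{RA}}+1)}$). Put $\delta_0=d_H\big(G^{-1}(\mathbf 1\oslash d^{(0)}),d^{(0)}\big)$ and $$B=\frac{\log\epsilon-\log\delta_0}{\log\tanh\big(\Delta(G^{-1})/4\big)} .$$ Then: 1. $0<\Delta(G^{-1})<\infty$ and $$\Delta(G^{-1})=\log\max_{i,j,p,q}\frac{g'_{p,i}\,g'_{q,j}}{g'_{p,j}\,g'_{q,i}} .$$ 2. The algorithm halts. If $\delta_0\le\epsilon$ then $t_{\mathrm{RA}}=0$, and if $\delta_0>\epsilon$ then $t_{\mathrm{RA}}\le\lceil B\rceil$. 3. Every $t\ge 0$ with $d_H(d^{(t+1)},d^{(t)})\ge\epsilon$ satisfies $t\le B$; in particular $t_{\mathrm{RA}}\le B$ whenever the algorithm halts with $d_H(d^{(t_{\mathrm{RA}}+1)},d^{(t_{\mathrm{RA}})})=\epsilon$. -/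

import Mathlib

open scoped Matrix

noncomputable section

/-- The Hilbert (projective) metric `log (max (x ⊘ y) / min (x ⊘ y))` of two positive vectors. -/
def hilbertMetric {K : ℕ} (x y : Fin K → ℝ) : ℝ :=
  Real.log ((⨆ i, x i / y i) / (⨅ i, x i / y i))

/-- The Hilbert distances between images under `T` of entrywise positive vectors. -/
def imageDistances {K : ℕ} (T : Matrix (Fin K) (Fin K) ℝ) : Set ℝ :=
  {r | ∃ x y : Fin K → ℝ, (∀ i, 0 < x i) ∧ (∀ i, 0 < y i) ∧
    r = hilbertMetric (T *ᵥ x) (T *ᵥ y)}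

/-- The projective diameter `sup {d_H(Tx, Ty) : x, y > 0}`. -/
def projectiveDiameter {K : ℕ} (T : Matrix (Fin K) (Fin K) ℝ) : ℝ :=
  sSup (imageDistances T)

/-- The interference coupling matrix `(A Aᵀ) ∘ M` (Hadamard product). -/
def couplingMatrix {K : ℕ} (A : Matrix (Fin K) (Fin K) ℤ) (M : Matrix (Fin K) (Fin K) ℝ) :
    Matrix (Fin K) (Fin K) ℝ :=
  Matrix.hadamard ((A * Aᵀ).map (fun z : ℤ => (z : ℝ))) M

/-- The normalization `Γ(x) = x / ∏ xᵢ^(1/K)`. -/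
def geomNormalize {K : ℕ} (x : Fin K → ℝ) : Fin K → ℝ :=
  fun j => x j / ∏ i, x i ^ (1 / (K : ℝ))

/-- The entrywise reciprocal `1 ⊘ d`. -/
def recip {K : ℕ} (d : Fin K → ℝ) : Fin K → ℝ := fun i => 1 / d i

/-- One update `d ↦ Γ(G⁻¹ (1 ⊘ d))`. -/
def raUpdate {K : ℕ} (G : Matrix (Fin K) (Fin K) ℝ) (d : Fin K → ℝ) : Fin K → ℝ :=
  geomNormalize (G⁻¹ *ᵥ recip d)

/-- The iterates `d^(t)`. -/
def raIterate {K : ℕ} (G : Matrix (Fin K) (Fin K) ℝ) (d₀ : Fin K → ℝ) (t : ℕ) : Fin K → ℝ :=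
  (raUpdate G)^[t] d₀

/-- Execution of the while loop of Reciprocal Approximation. `RALoop G ε d ang out n` says that the
loop `while ang > ε`, entered with current vector `d` and current value `ang`, halts with the vector
`out` after exactly `n` passes through its body. -/
inductive RALoop {K : ℕ} (G : Matrix (Fin K) (Fin K) ℝ) (ε : ℝ) :
    (Fin K → ℝ) → EReal → (Fin K → ℝ) → ℕ → Prop
  | halt (d : Fin K → ℝ) (ang : EReal) (h : ang ≤ (ε : EReal)) : RALoop G ε d ang d 0
  | pass (d : Fin K → ℝ) (ang : EReal) (out : Fin K → ℝ) (n : ℕ) (h : (ε : EReal) < ang)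
      (rest : RALoop G ε (raUpdate G d) (hilbertMetric (raUpdate G d) d : ℝ) out n) :
      RALoop G ε d ang out (n + 1)

/-- A run of Reciprocal Approximation from `d₀`: the loop is entered with `ang = +∞`. -/
def RARun {K : ℕ} (G : Matrix (Fin K) (Fin K) ℝ) (ε : ℝ) (d₀ out : Fin K → ℝ) (n : ℕ) : Prop :=
  RALoop G ε d₀ ⊤ out n

/-- The bound `(log ε − log d_H(G⁻¹(1 ⊘ d₀), d₀)) / log tanh(Δ(G⁻¹)/4)`. -/
def raBound {K : ℕ} (G : Matrix (Fin K) (Fin K) ℝ) (ε : ℝ) (d₀ : Fin K → ℝ) : ℝ :=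
  (Real.log ε - Real.log (hilbertMetric (G⁻¹ *ᵥ recip d₀) d₀)) /
    Real.log (Real.tanh (projectiveDiameter G⁻¹ / 4))

end

/-! The Hilbert metric is the oscillation of `log x - log y`, so it ignores scaling and is preserved
by reciprocals. The update therefore contracts as strongly as `G⁻¹` does, and Birkhoff's theorem
gives the factor τ = tanh(Δ/4) < 1. Successive distances are at most τ^t δ₀; comparing with ε and
taking logarithms gives the bounds.

Birkhoff's theorem (`hilbertMetric_mulVec_le_tanh_mul`) is proved along the path y·exp(s(log x - log
y)). The s-derivative of the log ratio of two image coordinates is a difference of two weighted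
means. The two weight vectors have cross ratios at most k² = e^Δ, so after normalization their total
variation distance is at most (k-1)/(k+1) = tanh(Δ/4). -/

/-! ### Total variation and log-sum-exp estimates -/

/-- Two numbers in `[0, 1]` whose odds ratio is at most `k ^ 2` differ by at most
`(k - 1) / (k + 1)`. -/
theorem sub_le_of_odds_ratio_le {α β k : ℝ} (hα0 : 0 ≤ α) (hα1 : α ≤ 1) (hβ0 : 0 ≤ β)
    (hβ1 : β ≤ 1) (hk : 1 ≤ k) (h : α * (1 - β) ≤ k ^ 2 * ((1 - α) * β)) :
    α - β ≤ (k - 1) / (k + 1) := by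
  have hα1' : 0 ≤ 1 - α := by linarith
  have hβ1' : 0 ≤ 1 - β := by linarith
  -- With α = sin²θ and β = sin²φ, the products P = ab' and Q = a'b satisfy P ± Q = sin(θ ± φ).
  -- Hence α - β = (P - Q)(P + Q), P + Q ≤ 1, and the hypothesis becomes P ≤ kQ.
  obtain ⟨a, ha0, rfl⟩ : ∃ a : ℝ, 0 ≤ a ∧ a ^ 2 = α := ⟨√α, Real.sqrt_nonneg _, Real.sq_sqrt hα0⟩
  obtain ⟨b, hb0, rfl⟩ : ∃ b : ℝ, 0 ≤ b ∧ b ^ 2 = β := ⟨√β, Real.sqrt_nonneg _, Real.sq_sqrt hβ0⟩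
  obtain ⟨a', ha'0, ha'⟩ : ∃ c : ℝ, 0 ≤ c ∧ c ^ 2 = 1 - a ^ 2 :=
    ⟨√(1 - a ^ 2), Real.sqrt_nonneg _, Real.sq_sqrt hα1'⟩
  obtain ⟨b', hb'0, hb'⟩ : ∃ c : ℝ, 0 ≤ c ∧ c ^ 2 = 1 - b ^ 2 :=
    ⟨√(1 - b ^ 2), Real.sqrt_nonneg _, Real.sq_sqrt hβ1'⟩
  have hP : 0 ≤ a * b' := mul_nonneg ha0 hb'0
  have hQ : 0 ≤ a' * b := mul_nonneg ha'0 hb0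
  have hPQ : a * b' ≤ k * (a' * b) := by
    refine abs_le_of_sq_le_sq' ?_ (by positivity) |>.2
    rw [← ha', ← hb'] at h
    linarith [h, mul_pow a b' 2, mul_pow k (a' * b) 2, mul_pow a' b 2]
  have hsum : a * b' + a' * b ≤ 1 := by
    nlinarith [sq_nonneg (a - b'), sq_nonneg (a' - b)]
  have hdiff : a ^ 2 - b ^ 2 = (a * b' - a' * b) * (a * b' + a' * b) := by
    have : (a * b' - a' * b) * (a * b' + a' * b) = a ^ 2 * b' ^ 2 - a' ^ 2 * b ^ 2 := by ring
    rw [this, ha', hb']; ring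
  rw [le_div_iff₀ (by linarith), hdiff]
  set P := a * b'
  set Q := a' * b
  have h1 : (P - Q) * (k + 1) ≤ (k - 1) * (P + Q) := by linarith
  have h2 := mul_le_mul_of_nonneg_right h1 (add_nonneg hP hQ)
  have h3 : (P + Q) * (P + Q) ≤ 1 := mul_le_one₀ hsum (add_nonneg hP hQ) hsum
  have h4 := mul_le_mul_of_nonneg_left h3 (sub_nonneg.2 hk)
  linarith

open Finset in
/-- The total variation bound for two probability vectors whose cross ratios are at most `k ^ 2`,
tested against a function of oscillation at most `D`. -/
theorem sum_mul_sub_sum_mul_le {ι : Type*} [Fintype ι] [Nonempty ι] {a b u : ι → ℝ} {k D : ℝ}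
    (ha : ∀ i, 0 ≤ a i) (hb : ∀ i, 0 ≤ b i) (ha1 : ∑ i, a i = 1) (hb1 : ∑ i, b i = 1)
    (hk : 1 ≤ k) (h : ∀ i j, a i * b j ≤ k ^ 2 * (a j * b i)) (hu : ∀ i j, u i - u j ≤ D) :
    ∑ i, a i * u i - ∑ i, b i * u i ≤ (k - 1) / (k + 1) * D := by
  classical
  obtain ⟨j₀, hj₀⟩ := Finite.exists_min u
  have hD : 0 ≤ D := by simpa using hu j₀ j₀
  -- The set on which the total variation distance is attained.
  set S : Finset ι := univ.filter fun i => b i ≤ a i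
  have ha2 : ∑ i ∈ Sᶜ, a i = 1 - ∑ i ∈ S, a i := by
    rw [← ha1, ← sum_add_sum_compl S]; ring
  have hb2 : ∑ i ∈ Sᶜ, b i = 1 - ∑ i ∈ S, b i := by
    rw [← hb1, ← sum_add_sum_compl S]; ring
  have hTV : ∑ i ∈ S, a i - ∑ i ∈ S, b i ≤ (k - 1) / (k + 1) := by
    refine sub_le_of_odds_ratio_le (sum_nonneg fun i _ => ha i) ?_ (sum_nonneg fun i _ => hb i) ?_
      hk ?_
    · linarith [sum_nonneg (s := Sᶜ) fun i _ => ha i]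
    · linarith [sum_nonneg (s := Sᶜ) fun i _ => hb i]
    · rw [← ha2, ← hb2, sum_mul_sum, mul_comm (∑ i ∈ Sᶜ, a i), sum_mul_sum, mul_sum]
      refine sum_le_sum fun i _ => ?_
      rw [mul_sum]
      exact sum_le_sum fun j _ => by linarith [h i j, mul_comm (a j) (b i)]
  -- Both masses are 1, so `u` may be shifted to have minimum 0; the terms outside `S` are then
  -- nonpositive.
  have hshift : ∑ i, a i * u i - ∑ i, b i * u i = ∑ i, (a i - b i) * (u i - u j₀) := by
    have : ∀ i, (a i - b i) * (u i - u j₀) = a i * u i - b i * u i - (a i * u j₀ - b i * u j₀) :=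
      fun i => by ring
    simp only [this, sum_sub_distrib, ← sum_mul, ha1, hb1]
    ring
  rw [hshift, ← sum_add_sum_compl S]
  have hneg : ∑ i ∈ Sᶜ, (a i - b i) * (u i - u j₀) ≤ 0 := by
    refine sum_nonpos fun i hi => mul_nonpos_of_nonpos_of_nonneg ?_ (sub_nonneg.2 (hj₀ i))
    simp only [S, mem_compl, mem_filter, mem_univ, true_and, not_le] at hi
    linarith
  have hposS : ∑ i ∈ S, (a i - b i) * (u i - u j₀) ≤ (∑ i ∈ S, a i - ∑ i ∈ S, b i) * D := by
    rw [← sum_sub_distrib, sum_mul]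
    refine sum_le_sum fun i hi => mul_le_mul_of_nonneg_left (hu i j₀) ?_
    simp only [S, mem_filter, mem_univ, true_and] at hi
    linarith
  linarith [mul_le_mul_of_nonneg_right hTV hD]

open Finset in
theorem weighted_mean_sub_le {ι : Type*} [Fintype ι] [Nonempty ι] {a b u : ι → ℝ} {k D : ℝ}
    (ha : ∀ i, 0 < a i) (hb : ∀ i, 0 < b i) (hk : 1 ≤ k)
    (h : ∀ i j, a i * b j ≤ k ^ 2 * (a j * b i)) (hu : ∀ i j, u i - u j ≤ D) :
    (∑ i, a i * u i) / ∑ i, a i - (∑ i, b i * u i) / ∑ i, b i ≤ (k - 1) / (k + 1) * D := by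
  have hA : 0 < ∑ i, a i := sum_pos (fun i _ => ha i) univ_nonempty
  have hB : 0 < ∑ i, b i := sum_pos (fun i _ => hb i) univ_nonempty
  have := sum_mul_sub_sum_mul_le (a := fun i => a i / ∑ i, a i) (b := fun i => b i / ∑ i, b i)
    (u := u) (k := k) (D := D) (fun i => (div_pos (ha i) hA).le) (fun i => (div_pos (hb i) hB).le)
    (by rw [← sum_div, div_self hA.ne']) (by rw [← sum_div, div_self hB.ne']) hk
    (fun i j => by
      rw [div_mul_div_comm, div_mul_div_comm, mul_div_assoc']
      exact div_le_div_of_nonneg_right (h i j) (mul_pos hA hB).le) hu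
  simpa only [div_mul_eq_mul_div, ← sum_div] using this

open Finset in
-- Mean value theorem on [0, 1] for `s * u`. Tilting both weight families by exp(s u) preserves the
-- cross-ratio condition, so the weighted-mean bound holds at every s.
theorem log_sum_exp_sub_le {ι : Type*} [Fintype ι] [Nonempty ι] {a b u : ι → ℝ} {k D : ℝ}
    (ha : ∀ i, 0 < a i) (hb : ∀ i, 0 < b i) (hk : 1 ≤ k)
    (h : ∀ i j, a i * b j ≤ k ^ 2 * (a j * b i)) (hu : ∀ i j, u i - u j ≤ D) :
    Real.log (∑ i, a i * Real.exp (u i)) - Real.log (∑ i, b i * Real.exp (u i)) -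
      (Real.log (∑ i, a i) - Real.log (∑ i, b i)) ≤ (k - 1) / (k + 1) * D := by
  have key : ∀ c : ι → ℝ, (∀ i, 0 < c i) → ∀ s : ℝ,
      HasDerivAt (fun s => Real.log (∑ i, c i * Real.exp (s * u i)))
        ((∑ i, c i * Real.exp (s * u i) * u i) / ∑ i, c i * Real.exp (s * u i)) s := by
    intro c hc s
    refine HasDerivAt.log ?_ (sum_pos (fun i _ => mul_pos (hc i) (Real.exp_pos _))
      univ_nonempty).ne'
    refine HasDerivAt.fun_sum fun i _ => ?_
    have := (((hasDerivAt_id s).mul_const (u i)).exp).const_mul (c i)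
    simpa [mul_assoc] using this
  have hd := fun s => (key a ha s).sub (key b hb s)
  obtain ⟨s, -, hs⟩ := exists_hasDerivAt_eq_slope _ _ (zero_lt_one' ℝ)
    (fun s _ => (hd s).continuousAt.continuousWithinAt) (fun s _ => hd s)
  have hle := weighted_mean_sub_le (a := fun i => a i * Real.exp (s * u i))
    (b := fun i => b i * Real.exp (s * u i)) (u := u)
    (fun i => mul_pos (ha i) (Real.exp_pos _)) (fun i => mul_pos (hb i) (Real.exp_pos _)) hk
    (fun i j => by
      have := mul_le_mul_of_nonneg_right (h i j)
        (mul_pos (Real.exp_pos (s * u i)) (Real.exp_pos (s * u j))).le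
      linarith) hu
  rw [hs] at hle
  simpa using hle

theorem tanh_div_four (Δ : ℝ) :
    Real.tanh (Δ / 4) = (Real.exp (Δ / 2) - 1) / (Real.exp (Δ / 2) + 1) := by
  have h : Real.exp (Δ / 2) = Real.exp (Δ / 4) * Real.exp (Δ / 4) := by
    rw [← Real.exp_add]; ring_nf
  rw [Real.tanh_eq_sinh_div_cosh, Real.sinh_eq, Real.cosh_eq, h, Real.exp_neg]
  have := Real.exp_pos (Δ / 4)
  field_simp

/-! ### Hilbert metric as an oscillation of logarithms -/

theorem hilbertMetric_le_iff {K : ℕ} [NeZero K] {x y : Fin K → ℝ} (hx : ∀ i, 0 < x i)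
    (hy : ∀ i, 0 < y i) {r : ℝ} :
    hilbertMetric x y ≤ r ↔
      ∀ i j, Real.log (x i) - Real.log (y i) - (Real.log (x j) - Real.log (y j)) ≤ r := by
  have hq : ∀ i, 0 < x i / y i := fun i => div_pos (hx i) (hy i)
  have hlog : ∀ i j, Real.log (x i) - Real.log (y i) - (Real.log (x j) - Real.log (y j)) =
      Real.log (x i / y i / (x j / y j)) := fun i j => by
    rw [Real.log_div (hq i).ne' (hq j).ne', Real.log_div (hx i).ne' (hy i).ne',
      Real.log_div (hx j).ne' (hy j).ne']
  obtain ⟨i₀, hi₀⟩ := exists_eq_ciSup_of_finite (f := fun i => x i / y i)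
  obtain ⟨j₀, hj₀⟩ := exists_eq_ciInf_of_finite (f := fun i => x i / y i)
  simp only [hlog]
  unfold hilbertMetric
  rw [← hi₀, ← hj₀]
  refine ⟨fun h i j => le_trans (Real.log_le_log (div_pos (hq i) (hq j)) ?_) h, fun h => h i₀ j₀⟩
  refine div_le_div₀ (hq i₀).le ?_ (hq j₀) ?_
  · rw [hi₀]; exact le_ciSup (f := fun i => x i / y i) (Set.finite_range _).bddAbove i
  · rw [hj₀]; exact ciInf_le (f := fun i => x i / y i) (Set.finite_range _).bddBelow j

theorem hilbertMetric_congr {K : ℕ} [NeZero K] {x y x' y' : Fin K → ℝ} (hx : ∀ i, 0 < x i)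
    (hy : ∀ i, 0 < y i) (hx' : ∀ i, 0 < x' i) (hy' : ∀ i, 0 < y' i)
    (h : ∀ i j, Real.log (x i) - Real.log (y i) - (Real.log (x j) - Real.log (y j)) =
      Real.log (x' i) - Real.log (y' i) - (Real.log (x' j) - Real.log (y' j))) :
    hilbertMetric x y = hilbertMetric x' y' :=
  eq_of_forall_ge_iff fun r => by
    simp only [hilbertMetric_le_iff hx hy, hilbertMetric_le_iff hx' hy', h]

theorem log_cross_le_hilbertMetric {K : ℕ} [NeZero K] {x y : Fin K → ℝ} (hx : ∀ i, 0 < x i)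
    (hy : ∀ i, 0 < y i) (i j : Fin K) :
    Real.log (x i) - Real.log (y i) - (Real.log (x j) - Real.log (y j)) ≤ hilbertMetric x y :=
  (hilbertMetric_le_iff hx hy).1 le_rfl i j

theorem recip_pos {K : ℕ} {d : Fin K → ℝ} (hd : ∀ i, 0 < d i) (i : Fin K) : 0 < recip d i :=
  one_div_pos.2 (hd i)

theorem hilbertMetric_recip {K : ℕ} [NeZero K] {x y : Fin K → ℝ} (hx : ∀ i, 0 < x i)
    (hy : ∀ i, 0 < y i) : hilbertMetric (recip x) (recip y) = hilbertMetric x y := by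
  refine eq_of_forall_ge_iff fun r => ?_
  rw [hilbertMetric_le_iff (recip_pos hx) (recip_pos hy), hilbertMetric_le_iff hx hy]
  simp only [recip, one_div, Real.log_inv]
  -- Reciprocals change the sign, which swapping the indices undoes.
  constructor <;> intro h i j <;> linarith [h j i]

theorem prod_rpow_pos {K : ℕ} {x : Fin K → ℝ} (hx : ∀ i, 0 < x i) :
    0 < ∏ i, x i ^ (1 / (K : ℝ)) :=
  Finset.prod_pos fun i _ => Real.rpow_pos_of_pos (hx i) _

theorem geomNormalize_pos {K : ℕ} {x : Fin K → ℝ} (hx : ∀ i, 0 < x i) (i : Fin K) :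
    0 < geomNormalize x i :=
  div_pos (hx i) (prod_rpow_pos hx)

theorem log_geomNormalize {K : ℕ} {x : Fin K → ℝ} (hx : ∀ i, 0 < x i) (i : Fin K) :
    Real.log (geomNormalize x i) = Real.log (x i) - Real.log (∏ i, x i ^ (1 / (K : ℝ))) :=
  Real.log_div (hx i).ne' (prod_rpow_pos hx).ne'

theorem hilbertMetric_geomNormalize_left {K : ℕ} [NeZero K] {x y : Fin K → ℝ}
    (hx : ∀ i, 0 < x i) (hy : ∀ i, 0 < y i) :
    hilbertMetric (geomNormalize x) y = hilbertMetric x y :=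
  hilbertMetric_congr (geomNormalize_pos hx) hy hx hy fun i j => by
    rw [log_geomNormalize hx, log_geomNormalize hx]; ring

theorem hilbertMetric_geomNormalize {K : ℕ} [NeZero K] {x y : Fin K → ℝ}
    (hx : ∀ i, 0 < x i) (hy : ∀ i, 0 < y i) :
    hilbertMetric (geomNormalize x) (geomNormalize y) = hilbertMetric x y :=
  hilbertMetric_congr (geomNormalize_pos hx) (geomNormalize_pos hy) hx hy fun i j => by
    simp only [log_geomNormalize hx, log_geomNormalize hy]; ring

/-! ### Projective diameter and cross ratios -/

theorem mulVec_pos {K : ℕ} [NeZero K] {T : Matrix (Fin K) (Fin K) ℝ} (hT : ∀ i j, 0 < T i j)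
    {x : Fin K → ℝ} (hx : ∀ i, 0 < x i) (i : Fin K) : 0 < (T *ᵥ x) i :=
  Finset.sum_pos (fun j _ => mul_pos (hT i j) (hx j)) Finset.univ_nonempty

/-- Bounding the Hilbert metric by `log R` amounts to bounding the cross ratios by `R`. -/
theorem log_cross_le_log_iff {a b c d R : ℝ} (ha : 0 < a) (hb : 0 < b) (hc : 0 < c) (hd : 0 < d)
    (hR : 0 < R) :
    Real.log a - Real.log b - (Real.log c - Real.log d) ≤ Real.log R ↔ a * d ≤ R * (b * c) := by
  rw [← Real.log_le_log_iff (mul_pos ha hd) (mul_pos hR (mul_pos hb hc)),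
    Real.log_mul ha.ne' hd.ne', Real.log_mul hR.ne' (mul_pos hb hc).ne',
    Real.log_mul hb.ne' hc.ne']
  constructor <;> intro h <;> linarith

open Finset in
theorem hilbertMetric_mulVec_le_log {K : ℕ} [NeZero K] {T : Matrix (Fin K) (Fin K) ℝ}
    (hT : ∀ i j, 0 < T i j) {R : ℝ} (hR : 0 < R)
    (h : ∀ i j p q, T p i * T q j ≤ R * (T p j * T q i)) {x y : Fin K → ℝ}
    (hx : ∀ i, 0 < x i) (hy : ∀ i, 0 < y i) :
    hilbertMetric (T *ᵥ x) (T *ᵥ y) ≤ Real.log R := by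
  rw [hilbertMetric_le_iff (mulVec_pos hT hx) (mulVec_pos hT hy)]
  intro p q
  rw [log_cross_le_log_iff (mulVec_pos hT hx p) (mulVec_pos hT hy p) (mulVec_pos hT hx q)
    (mulVec_pos hT hy q) hR]
  simp only [Matrix.mulVec, dotProduct]
  rw [sum_mul_sum, mul_comm (∑ i, T p i * y i), sum_mul_sum, mul_sum]
  refine sum_le_sum fun i _ => ?_
  rw [mul_sum]
  refine sum_le_sum fun j _ => ?_
  have := mul_le_mul_of_nonneg_right (h i j p q) (mul_pos (hx i) (hy j)).le
  linarith

/-- Conversely, a bound for the image distances bounds the cross ratios of the matrix: let the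
vectors tend to standard basis vectors. -/
theorem cross_le_of_hilbertMetric_mulVec_le {K : ℕ} [NeZero K] {T : Matrix (Fin K) (Fin K) ℝ}
    (hT : ∀ i j, 0 < T i j) {R : ℝ} (hR : 0 < R)
    (h : ∀ x y : Fin K → ℝ, (∀ i, 0 < x i) → (∀ i, 0 < y i) →
      hilbertMetric (T *ᵥ x) (T *ᵥ y) ≤ Real.log R) (i j p q : Fin K) :
    T p i * T q j ≤ R * (T p j * T q i) := by
  -- Positive for s > 0; at s = 0 it is a basis vector, where the closed inequality survives by
  -- continuity.
  let v : Fin K → ℝ → Fin K → ℝ := fun i s => Pi.single i 1 + fun _ => s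
  have hv : ∀ i s, 0 < s → ∀ l, 0 < v i s l := fun i s hs l =>
    add_pos_of_nonneg_of_pos ((Pi.single_nonneg.2 zero_le_one : (0 : Fin K → ℝ) ≤ _) l) hs
  have hc : ∀ i p, Continuous fun s => (T *ᵥ v i s) p := fun i p => by
    have : Continuous (v i) := by fun_prop
    exact (continuous_apply p).comp (continuous_const.matrix_mulVec this)
  have h0 : ∀ i p, (T *ᵥ v i 0) p = T p i := fun i p => by
    have : v i 0 = Pi.single i 1 := by ext l; simp [v]
    rw [this, Matrix.mulVec_single_one]; rfl
  have hle : ∀ s ∈ Set.Ioi (0 : ℝ), (T *ᵥ v i s) p * (T *ᵥ v j s) q ≤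
      R * ((T *ᵥ v j s) p * (T *ᵥ v i s) q) := fun s hs => by
    have hi := mulVec_pos hT (hv i s hs)
    have hj := mulVec_pos hT (hv j s hs)
    exact (log_cross_le_log_iff (hi p) (hj p) (hi q) (hj q) hR).1
      ((hilbertMetric_le_iff hi hj).1 (h _ _ (hv i s hs) (hv j s hs)) p q)
  have := le_on_closure hle ((hc i p).mul (hc j q)).continuousOn
    (continuous_const.mul ((hc j p).mul (hc i q))).continuousOn
    (x := 0) (by rw [closure_Ioi]; exact Set.self_mem_Ici)
  simpa only [h0] using this

/-- The largest cross ratio of a matrix. -/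
noncomputable def maxCrossRatio {K : ℕ} (T : Matrix (Fin K) (Fin K) ℝ) : ℝ :=
  ⨆ i, ⨆ j, ⨆ p, ⨆ q, (T p i * T q j) / (T p j * T q i)

theorem cross_ratio_le_maxCrossRatio {K : ℕ} (T : Matrix (Fin K) (Fin K) ℝ) (i j p q : Fin K) :
    (T p i * T q j) / (T p j * T q i) ≤ maxCrossRatio T := by
  refine le_trans ?_ (le_ciSup (Set.finite_range _).bddAbove i)
  refine le_trans ?_ (le_ciSup (Set.finite_range _).bddAbove j)
  refine le_trans ?_ (le_ciSup (Set.finite_range _).bddAbove p)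
  exact le_ciSup (f := fun q => (T p i * T q j) / (T p j * T q i)) (Set.finite_range _).bddAbove q

theorem maxCrossRatio_le_iff {K : ℕ} [NeZero K] {T : Matrix (Fin K) (Fin K) ℝ}
    (hT : ∀ i j, 0 < T i j) {R : ℝ} :
    maxCrossRatio T ≤ R ↔ ∀ i j p q, T p i * T q j ≤ R * (T p j * T q i) := by
  refine ⟨fun h i j p q => ?_, fun h => ?_⟩
  · rw [← div_le_iff₀ (mul_pos (hT p j) (hT q i))]
    exact (cross_ratio_le_maxCrossRatio T i j p q).trans h
  · refine ciSup_le fun i => ciSup_le fun j => ciSup_le fun p => ciSup_le fun q => ?_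
    rw [div_le_iff₀ (mul_pos (hT p j) (hT q i))]
    exact h i j p q

theorem one_le_maxCrossRatio {K : ℕ} [NeZero K] {T : Matrix (Fin K) (Fin K) ℝ}
    (hT : ∀ i j, 0 < T i j) : 1 ≤ maxCrossRatio T := by
  have := cross_ratio_le_maxCrossRatio T 0 0 0 0
  rwa [div_self (mul_pos (hT _ _) (hT _ _)).ne'] at this

theorem log_maxCrossRatio_mem_upperBounds {K : ℕ} [NeZero K] {T : Matrix (Fin K) (Fin K) ℝ}
    (hT : ∀ i j, 0 < T i j) : Real.log (maxCrossRatio T) ∈ upperBounds (imageDistances T) := by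
  rintro r ⟨x, y, hx, hy, rfl⟩
  exact hilbertMetric_mulVec_le_log hT (zero_lt_one.trans_le (one_le_maxCrossRatio hT))
    ((maxCrossRatio_le_iff hT).1 le_rfl) hx hy

theorem projectiveDiameter_eq_log_maxCrossRatio {K : ℕ} [NeZero K]
    {T : Matrix (Fin K) (Fin K) ℝ} (hT : ∀ i j, 0 < T i j) :
    projectiveDiameter T = Real.log (maxCrossRatio T) := by
  have hub := log_maxCrossRatio_mem_upperBounds hT
  have hne : (imageDistances T).Nonempty :=
    ⟨_, fun _ => 1, fun _ => 1, fun _ => one_pos, fun _ => one_pos, rfl⟩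
  refine le_antisymm (csSup_le hne hub) ?_
  rw [Real.log_le_iff_le_exp (zero_lt_one.trans_le (one_le_maxCrossRatio hT)),
    maxCrossRatio_le_iff hT]
  refine cross_le_of_hilbertMetric_mulVec_le hT (Real.exp_pos _) fun x y hx hy => ?_
  rw [Real.log_exp]
  exact le_csSup ⟨_, hub⟩ ⟨x, y, hx, hy, rfl⟩

/-- If no cross ratio exceeds 1, swapping indices forces all to equal 1, so two columns are
proportional, contradicting invertibility. -/
theorem one_lt_maxCrossRatio {K : ℕ} [NeZero K] (hK : 2 ≤ K) {T : Matrix (Fin K) (Fin K) ℝ}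
    (hT : ∀ i j, 0 < T i j) (hdet : IsUnit T.det) : 1 < maxCrossRatio T := by
  by_contra! hle
  have hcross := (maxCrossRatio_le_iff hT).1 hle
  let i : Fin K := ⟨0, by omega⟩
  let j : Fin K := ⟨1, by omega⟩
  have hij : i ≠ j := by simp [i, j]
  have hv : T *ᵥ (T i j • Pi.single i 1 - T i i • Pi.single j 1) = 0 := by
    ext q
    rw [Matrix.mulVec_sub, Matrix.mulVec_smul, Matrix.mulVec_smul, Matrix.mulVec_single_one,
      Matrix.mulVec_single_one]
    simp only [Pi.sub_apply, Pi.smul_apply, smul_eq_mul, Matrix.col_apply, Pi.zero_apply]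
    linarith [hcross i j i q, hcross j i i q]
  have h0 := congrFun (Matrix.eq_zero_of_mulVec_eq_zero hdet.ne_zero hv) i
  simp [hij] at h0
  exact (hT i j).ne' h0

/-! ### Birkhoff contraction -/

/-- **Birkhoff's contraction theorem** for positive matrices. -/
theorem hilbertMetric_mulVec_le_tanh_mul {K : ℕ} [NeZero K] {T : Matrix (Fin K) (Fin K) ℝ}
    (hT : ∀ i j, 0 < T i j) {x y : Fin K → ℝ} (hx : ∀ i, 0 < x i) (hy : ∀ i, 0 < y i) :
    hilbertMetric (T *ᵥ x) (T *ᵥ y) ≤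
      Real.tanh (projectiveDiameter T / 4) * hilbertMetric x y := by
  have hR : 0 < maxCrossRatio T := zero_lt_one.trans_le (one_le_maxCrossRatio hT)
  rw [hilbertMetric_le_iff (mulVec_pos hT hx) (mulVec_pos hT hy), tanh_div_four]
  intro p q
  have hk2 : Real.exp (projectiveDiameter T / 2) ^ 2 = maxCrossRatio T := by
    rw [← Real.exp_nat_mul, projectiveDiameter_eq_log_maxCrossRatio hT]
    push_cast
    rw [mul_div_cancel₀ _ two_ne_zero, Real.exp_log hR]
  have hk : 1 ≤ Real.exp (projectiveDiameter T / 2) := by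
    rw [Real.one_le_exp_iff, projectiveDiameter_eq_log_maxCrossRatio hT]
    exact div_nonneg (Real.log_nonneg (one_le_maxCrossRatio hT)) zero_le_two
  have hxy : ∀ p, ∑ i, T p i * y i * Real.exp (Real.log (x i) - Real.log (y i)) = (T *ᵥ x) p :=
    fun p => Finset.sum_congr rfl fun i _ => by
      rw [Real.exp_sub, Real.exp_log (hx i), Real.exp_log (hy i), mul_assoc,
        mul_div_cancel₀ _ (hy i).ne']
  have := log_sum_exp_sub_le (a := fun i => T p i * y i) (b := fun i => T q i * y i)
    (u := fun i => Real.log (x i) - Real.log (y i)) (fun i => mul_pos (hT p i) (hy i))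
    (fun i => mul_pos (hT q i) (hy i)) hk
    (fun i j => by
      have := mul_le_mul_of_nonneg_right ((maxCrossRatio_le_iff hT).1 le_rfl i j p q)
        (mul_pos (hy i) (hy j)).le
      rw [hk2]
      linarith) (log_cross_le_hilbertMetric hx hy)
  rw [hxy, hxy] at this
  change Real.log ((T *ᵥ x) p) - Real.log ((T *ᵥ x) q) -
    (Real.log ((T *ᵥ y) p) - Real.log ((T *ᵥ y) q)) ≤ _ at this
  linarith

/-! ### Iterates, loop execution and the pass count -/

theorem raUpdate_pos {K : ℕ} [NeZero K] {G : Matrix (Fin K) (Fin K) ℝ}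
    (hpos : ∀ i j, 0 < G⁻¹ i j) {d : Fin K → ℝ} (hd : ∀ i, 0 < d i) (i : Fin K) :
    0 < raUpdate G d i :=
  geomNormalize_pos (mulVec_pos hpos (recip_pos hd)) i

theorem raIterate_succ {K : ℕ} (G : Matrix (Fin K) (Fin K) ℝ) (d₀ : Fin K → ℝ) (t : ℕ) :
    raIterate G d₀ (t + 1) = raUpdate G (raIterate G d₀ t) :=
  Function.iterate_succ_apply' _ _ _

theorem raIterate_pos {K : ℕ} [NeZero K] {G : Matrix (Fin K) (Fin K) ℝ}
    (hpos : ∀ i j, 0 < G⁻¹ i j) {d₀ : Fin K → ℝ} (hd : ∀ i, 0 < d₀ i) (t : ℕ) :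
    ∀ i, 0 < raIterate G d₀ t i := by
  induction t with
  | zero => exact hd
  | succ t ih => rw [raIterate_succ]; exact raUpdate_pos hpos ih

theorem hilbertMetric_raUpdate_le {K : ℕ} [NeZero K] {G : Matrix (Fin K) (Fin K) ℝ}
    (hpos : ∀ i j, 0 < G⁻¹ i j) {d e : Fin K → ℝ} (hd : ∀ i, 0 < d i) (he : ∀ i, 0 < e i) :
    hilbertMetric (raUpdate G d) (raUpdate G e) ≤
      Real.tanh (projectiveDiameter G⁻¹ / 4) * hilbertMetric d e := by
  unfold raUpdate
  rw [hilbertMetric_geomNormalize (mulVec_pos hpos (recip_pos hd))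
    (mulVec_pos hpos (recip_pos he)), ← hilbertMetric_recip hd he]
  exact hilbertMetric_mulVec_le_tanh_mul hpos (recip_pos hd) (recip_pos he)

theorem hilbertMetric_raIterate_one {K : ℕ} [NeZero K] {G : Matrix (Fin K) (Fin K) ℝ}
    (hpos : ∀ i j, 0 < G⁻¹ i j) {d₀ : Fin K → ℝ} (hd : ∀ i, 0 < d₀ i) :
    hilbertMetric (raIterate G d₀ (0 + 1)) (raIterate G d₀ 0) =
      hilbertMetric (G⁻¹ *ᵥ recip d₀) d₀ :=
  hilbertMetric_geomNormalize_left (mulVec_pos hpos (recip_pos hd)) hd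

theorem hilbertMetric_raIterate_le {K : ℕ} [NeZero K] {G : Matrix (Fin K) (Fin K) ℝ}
    (hpos : ∀ i j, 0 < G⁻¹ i j) (hτ : 0 ≤ Real.tanh (projectiveDiameter G⁻¹ / 4))
    {d₀ : Fin K → ℝ} (hd : ∀ i, 0 < d₀ i) (t : ℕ) :
    hilbertMetric (raIterate G d₀ (t + 1)) (raIterate G d₀ t) ≤
      Real.tanh (projectiveDiameter G⁻¹ / 4) ^ t * hilbertMetric (G⁻¹ *ᵥ recip d₀) d₀ := by
  induction t with
  | zero => rw [hilbertMetric_raIterate_one hpos hd, pow_zero, one_mul]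
  | succ t ih =>
    rw [raIterate_succ G d₀ (t + 1), raIterate_succ G d₀ t, pow_succ', mul_assoc]
    rw [raIterate_succ] at ih
    refine (hilbertMetric_raUpdate_le hpos (raUpdate_pos hpos (raIterate_pos hpos hd t))
      (raIterate_pos hpos hd t)).trans (mul_le_mul_of_nonneg_left ih hτ)

/-- The entry value `ang` is arbitrary above ε, so the induction covers both the initial `⊤` and
later distances. -/
theorem raLoop_raIterate {K : ℕ} {G : Matrix (Fin K) (Fin K) ℝ} {ε : ℝ} (t : ℕ) :
    ∀ (d : Fin K → ℝ) (ang : EReal), (ε : EReal) < ang →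
      (∀ s < t, ε < hilbertMetric (raIterate G d (s + 1)) (raIterate G d s)) →
      hilbertMetric (raIterate G d (t + 1)) (raIterate G d t) ≤ ε →
      RALoop G ε d ang (raIterate G d (t + 1)) (t + 1) := by
  induction t with
  | zero =>
    intro d ang hang _ hle
    exact .pass _ _ _ _ hang (.halt _ _ (EReal.coe_le_coe_iff.2 hle))
  | succ t ih =>
    intro d ang hang hlt hle
    exact .pass _ _ _ _ hang (ih (raUpdate G d) _ (EReal.coe_lt_coe_iff.2 (hlt 0 t.succ_pos))
      (fun s hs => hlt (s + 1) (Nat.succ_lt_succ hs)) hle)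

theorem le_log_div_log_of_le_pow_mul {ε δ τ : ℝ} (hε : 0 < ε) (hτ0 : 0 < τ) (hτ1 : τ < 1) {t : ℕ}
    (h : ε ≤ τ ^ t * δ) : (t : ℝ) ≤ (Real.log ε - Real.log δ) / Real.log τ := by
  have hδ : 0 < δ := pos_of_mul_pos_right (hε.trans_le h) (pow_pos hτ0 t).le
  have := Real.log_le_log hε h
  rw [Real.log_mul (pow_pos hτ0 t).ne' hδ.ne', Real.log_pow] at this
  rw [le_div_iff_of_neg (Real.log_neg hτ0 hτ1)]
  linarith

theorem lt_log_div_log_of_lt_pow_mul {ε δ τ : ℝ} (hε : 0 < ε) (hτ0 : 0 < τ) (hτ1 : τ < 1) {t : ℕ}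
    (h : ε < τ ^ t * δ) : (t : ℝ) < (Real.log ε - Real.log δ) / Real.log τ := by
  have hδ : 0 < δ := pos_of_mul_pos_right (hε.trans h) (pow_pos hτ0 t).le
  have := Real.log_lt_log hε h
  rw [Real.log_mul (pow_pos hτ0 t).ne' hδ.ne', Real.log_pow] at this
  rw [lt_div_iff_of_neg (Real.log_neg hτ0 hτ1)]
  linarith

theorem mainTheorem3 {K : ℕ} (hK : 2 ≤ K)
    (A : Matrix (Fin K) (Fin K) ℤ) (M G : Matrix (Fin K) (Fin K) ℝ)
    (hG : G = couplingMatrix A M)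
    (hpos : ∀ i j, 0 < G⁻¹ i j)
    (ε : ℝ) (hε : 0 < ε)
    (d₀ : Fin K → ℝ) (hd₀ : ∀ i, 0 < d₀ i) :
    -- the projective diameter is finite, positive and given by the formula
    (BddAbove (imageDistances G⁻¹) ∧ 0 < projectiveDiameter G⁻¹ ∧
      projectiveDiameter G⁻¹ =
        Real.log (⨆ i, ⨆ j, ⨆ p, ⨆ q,
          (G⁻¹ p i * G⁻¹ q j) / (G⁻¹ p j * G⁻¹ q i))) ∧
    -- the algorithm halts, in the pass that computes `d^(t+1)` from `d^(t)`
    (∃ t : ℕ, RARun G ε d₀ (raIterate G d₀ (t + 1)) (t + 1) ∧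
      (hilbertMetric (G⁻¹ *ᵥ recip d₀) d₀ ≤ ε → t = 0) ∧
      (ε < hilbertMetric (G⁻¹ *ᵥ recip d₀) d₀ → (t : ℤ) ≤ ⌈raBound G ε d₀⌉)) ∧
    -- the bound without rounding, for the indices at which the threshold is still attained
    (∀ t : ℕ, ε ≤ hilbertMetric (raIterate G d₀ (t + 1)) (raIterate G d₀ t) →
      (t : ℝ) ≤ raBound G ε d₀) := by
  have : NeZero K := ⟨by omega⟩
  -- The inverse of a singular matrix is 0 by convention, so positive entries force invertibility.
  have hdet : IsUnit (G⁻¹).det := by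
    rw [Matrix.isUnit_nonsing_inv_det_iff]
    by_contra h
    have h00 := hpos 0 0
    rw [Matrix.nonsing_inv_apply_not_isUnit _ h] at h00
    exact lt_irrefl _ h00
  have hdiam : projectiveDiameter G⁻¹ = Real.log (maxCrossRatio G⁻¹) :=
    projectiveDiameter_eq_log_maxCrossRatio hpos
  have hΔ : 0 < projectiveDiameter G⁻¹ := by
    rw [hdiam]; exact Real.log_pos (one_lt_maxCrossRatio hK hpos hdet)
  have hk : 1 < Real.exp (projectiveDiameter G⁻¹ / 2) := Real.one_lt_exp_iff.2 (half_pos hΔ)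
  have hτ0 : 0 < Real.tanh (projectiveDiameter G⁻¹ / 4) := by
    rw [tanh_div_four]; exact div_pos (by linarith) (by linarith)
  have hτ1 : Real.tanh (projectiveDiameter G⁻¹ / 4) < 1 := by
    rw [tanh_div_four, div_lt_one (by linarith)]; linarith
  have hstep := hilbertMetric_raIterate_le hpos hτ0.le hd₀
  refine ⟨⟨⟨_, log_maxCrossRatio_mem_upperBounds hpos⟩, hΔ, hdiam⟩, ?_, fun t ht =>
    le_log_div_log_of_le_pow_mul hε hτ0 hτ1 (ht.trans (hstep t))⟩
  have hex : ∃ t, hilbertMetric (raIterate G d₀ (t + 1)) (raIterate G d₀ t) ≤ ε := by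
    have hlim := (tendsto_pow_atTop_nhds_zero_of_lt_one hτ0.le hτ1).mul_const
      (hilbertMetric (G⁻¹ *ᵥ recip d₀) d₀)
    rw [zero_mul] at hlim
    obtain ⟨t, ht⟩ := (hlim.eventually (gt_mem_nhds hε)).exists
    exact ⟨t, (hstep t).trans ht.le⟩
  classical
  have hmin : ∀ s < Nat.find hex,
      ε < hilbertMetric (raIterate G d₀ (s + 1)) (raIterate G d₀ s) :=
    fun s hs => not_le.1 (Nat.find_min hex hs)
  refine ⟨Nat.find hex, raLoop_raIterate _ _ _ (EReal.coe_lt_top ε) hmin (Nat.find_spec hex),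
    fun h => ?_, fun h => ?_⟩
  · rw [Nat.find_eq_zero, hilbertMetric_raIterate_one hpos hd₀]; exact h
  -- Pass s = t - 1 did not halt, so s < B strictly, and t = s + 1 ≤ ⌈B⌉. For t = 0, δ₀ > ε gives B
  -- ≥ 0.
  · rcases hn : Nat.find hex with _ | s
    · have h0 := le_log_div_log_of_le_pow_mul hε hτ0 hτ1 (t := 0) (by simpa using h.le)
      rw [Nat.cast_zero] at h0
      exact Int.ceil_nonneg h0
    · have hs := lt_log_div_log_of_lt_pow_mul hε hτ0 hτ1
        ((hmin s (by omega)).trans_le (hstep s))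
      have : (s : ℤ) < ⌈raBound G ε d₀⌉ := Int.lt_ceil.2 (by exact_mod_cast hs)
      push_cast
      omega
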